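/- Let $n,k\ge 0$ be integers and let $q$ be an indeterminate. Put $[m]_q=1+q+\dots+q^{m-1}$ and let $\begin{bmatrix} i\\ j\end{bmatrix}_q=\prod_{r=1}^{j}\frac{[i-j+r]_q}{[r]_q}$ be the $q$-binomial coefficient. Let $\Pi_n$ be the set of set partitions of $\{1,\dots,n\}$, and let $|\pi|$ be the number of blocks of $\pi\in\Pi_n$. An arc of $\pi$ is a pair $(a,b)$ with $a<b$ of consecutive elements of a block of $\pi$, and $\mathrm{cro}(\pi)$ is the number of crossings of $\pi$, that is, of pairs of arcs $(a,b)$, $(c,d)$ with $a<c<b<d$. Then, in $\mathbb{Q}(q)$, $$\sum_{\substack{\pi\in\Pi_n\\ |\pi|=k}} q^{\mathrm{cro}(\pi)} = S_{n,k}(q) := \frac{1}{(1-q)^{n-k}}\sum_{j=0}^{k}\sum_{i=j}^{n-k}(-1)^i\left(\binom{n}{k+i}\binom{n}{k-j}-\binom{n}{k+i+1}\binom{n}{k-j-1}\right)\begin{bmatrix} i\\ j\end{bmatrix}_q q^{\binom{j+1}{2}},$$ where binomial coefficients with a negative lower index and empty sums are $0$. Moreover, let $y$ be a further indeterminate and let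 the $q$-Charlier polynomials $C_n=C_n(x;y|q)$ be given by $C_0=1$ and $xC_n=C_{n+1}+(y+[n]_q)C_n+y[n]_q C_{n-1}$ for $n\ge 0$ (without the last term if $n=0$). There is exactly one $\mathbb{Q}(q)[y]$-linear functional $L$ on $\mathbb{Q}(q)[y][x]$ with $L(1)=1$, $L(C_mC_n)=0$ for $m\ne n$, and $L(C_n^2)\neq 0$ for all $n$, and the moments of the $q$-Charlier polynomials are $L(x^n)=\sum_{k=0}^{n} S_{n,k}(q)\,y^k$ for all $n\ge 0$. -/

import Mathlib

/-- The arcs of a set partition `π` of `{1, …, n}`: the pairs `(i, j)` of consecutive elements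
of a block of `π`, that is, `i < j` lie in a common block which has no element strictly between
`i` and `j`. -/
def setPartitionArcs {n : ℕ} (π : Finpartition (Finset.Icc 1 n)) : Finset (ℕ × ℕ) :=
  (Finset.Icc 1 n ×ˢ Finset.Icc 1 n).filter fun a =>
    a.1 < a.2 ∧ ∃ B ∈ π.parts, a.1 ∈ B ∧ a.2 ∈ B ∧ ∀ m ∈ B, ¬(a.1 < m ∧ m < a.2)

/-- The number of crossings of a set partition: the number of pairs of arcs
`(i, j)`, `(k, l)` with `i < k < j < l`. -/
def setPartitionCro {n : ℕ} (π : Finpartition (Finset.Icc 1 n)) : ℕ :=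
  ((setPartitionArcs π ×ˢ setPartitionArcs π).filter fun c =>
    c.1.1 < c.2.1 ∧ c.2.1 < c.1.2 ∧ c.1.2 < c.2.2).card

/-- The `q`-integer `[n]_q = 1 + q + ⋯ + q ^ (n - 1)`. -/
def qInteger {R : Type*} [CommRing R] (q : R) (n : ℕ) : R :=
  ∑ i ∈ Finset.range n, q ^ i

/-- The `q`-binomial coefficient `∏_{i = 1}^{k} [n - k + i]_q / [i]_q`.
The index is written `n + i - k`; if `k > n`, the product contains the factor `[0]_q = 0`. -/
def qBinomial {K : Type*} [Field K] (q : K) (n k : ℕ) : K :=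
  ∏ i ∈ Finset.Icc 1 k, qInteger q (n + i - k) / qInteger q i

/-- The ordinary binomial coefficient with an integer lower index; it vanishes if the lower index
is negative. -/
def binomialInt (n : ℕ) (m : ℤ) : ℤ :=
  if 0 ≤ m then (n.choose m.toNat : ℤ) else 0

/-- The closed formula
`(1 - q)^{-(n-k)} ∑_{j=0}^{k} ∑_{i=j}^{n-k} (-1)^i
  (binom(n,k+i) binom(n,k-j) - binom(n,k+i+1) binom(n,k-j-1)) [i choose j]_q q^{binom(j+1,2)}`.
For `k > n` the inner range `Finset.Icc j (n - k)` contains at most `i = 0`, whose summand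
vanishes since `binom(n,k) = binom(n,k+1) = 0`; so the value is `0`, as for an empty sum. -/
def charlierFormula {K : Type*} [Field K] (q : K) (n k : ℕ) : K :=
  1 / (1 - q) ^ ((n : ℤ) - (k : ℤ)) *
    ∑ j ∈ Finset.range (k + 1), ∑ i ∈ Finset.Icc j (n - k),
      (-1) ^ i *
        ((binomialInt n ((k : ℤ) + i) * binomialInt n ((k : ℤ) - j)
          - binomialInt n ((k : ℤ) + i + 1) * binomialInt n ((k : ℤ) - j - 1) : ℤ) : K) *
        qBinomial q i j * q ^ (j + 1).choose 2

/-- The `q`-Charlier polynomials `C_n(x; y | q)` of Kim, Stanton and Zeng, as polynomials in `x`: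
`C_0 = 1` and `x C_n = C_{n+1} + (y + [n]_q) C_n + y [n]_q C_{n-1}` for all `n ≥ 0`
(where the last term is absent for `n = 0`). -/
noncomputable def qCharlier {R : Type*} [CommRing R] (q y : R) : ℕ → Polynomial R
  | 0 => 1
  | 1 => Polynomial.X - Polynomial.C y
  | n + 2 =>
      (Polynomial.X - Polynomial.C (y + qInteger q (n + 1))) * qCharlier q y (n + 1)
        - Polynomial.C (y * qInteger q (n + 1)) * qCharlier q y n

/-- `L` is the normalised linear functional with respect to which the sequence `P` of polynomials
is orthogonal; the moments of `P` are the values `L (x ^ n)`. -/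
structure IsOrthogonalityFunctional {R : Type*} [CommRing R] (P : ℕ → Polynomial R)
    (L : Polynomial R →ₗ[R] R) : Prop where
  map_one : L 1 = 1
  map_mul_eq_zero : ∀ m n : ℕ, m ≠ n → L (P m * P n) = 0
  map_mul_self_ne_zero : ∀ n : ℕ, L (P n * P n) ≠ 0

/-! All quantities are compared with one: the weight of Motzkin paths of length n with up steps 1,
level steps y + [i]_q and down steps y[i]_q.

Moments: in the basis C_h, multiplication by x is tridiagonal, so the coefficients of x^n are
weights of Motzkin prefixes (`IsThreeTerm.X_pow_eq`). A normalised orthogonality functional kills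
C_h for h > 0, so its n-th moment is the weight of the paths ending at height 0; this gives
uniqueness. Conversely, the functional with these moments is orthogonal, with L(C_n^2) = l_1 ⋯ l_n.

Partitions: a partition is built by inserting 1, 2, … in turn. Some block maxima are marked as
starts of half-infinite arcs, and crossings with these are counted as well. Ending one of h marked
arcs at the new point creates a crossing with each marked arc that starts later, and the choice
contributes [h]_q. The number of marked arcs thus performs a weighted Motzkin path
(`sum_openWeight_eq_motzkinWeight`).

Closed formula: after rescaling by 1 - q, with z = (1 - q)y, the level and down weights are 1 + z -
q^i and z(1 - q^i). Without the powers of q they are constant, and prefixes are counted by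
differences of products of binomials, as in the reflection principle (`ballotSum`). The polynomials
of the constant weights expand in those of the true weights with explicit coefficients
(`connectionCoeff`). Composing the two expansions of x^n and collecting powers of z gives the double
sum (`sum_ballotSum_mul_connectionCoeff`). -/

/-- The sequence `v` shifted by one place to the right, with `0` as first term. -/
def shiftRight {R : Type*} [Zero R] (v : ℕ → R) : ℕ → R
  | 0 => 0
  | n + 1 => v n

/-- The total weight of the Motzkin prefixes with `n` steps from height `0` to height `h`, where
up steps have weight `1`, level steps at height `i` have weight `b i`, and down steps from height
`i` have weight `l i`. -/
def motzkinWeight {R : Type*} [CommRing R] (b l : ℕ → R) : ℕ → ℕ → R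
  | 0, h => if h = 0 then 1 else 0
  | n + 1, h => shiftRight (motzkinWeight b l n) h + b h * motzkinWeight b l n h
      + l (h + 1) * motzkinWeight b l n (h + 1)

/-! ### Moments of orthogonal polynomials as weighted Motzkin paths -/

section Orthogonality

open Polynomial

variable {R : Type*} [CommRing R] {b l : ℕ → R}

theorem motzkinWeight_eq_zero {n h : ℕ} (hh : n < h) : motzkinWeight b l n h = 0 := by
  induction n generalizing h with
  | zero => simp [motzkinWeight, Nat.pos_iff_ne_zero.mp hh]
  | succ n ih =>
    obtain ⟨k, rfl⟩ : ∃ k, h = k + 1 := ⟨h - 1, by omega⟩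
    simp [motzkinWeight, shiftRight, ih (show n < k by omega), ih (show n < k + 1 by omega),
      ih (show n < k + 1 + 1 by omega)]

theorem motzkinWeight_self (n : ℕ) : motzkinWeight b l n n = 1 := by
  induction n with
  | zero => simp [motzkinWeight]
  | succ n ih =>
    simp [motzkinWeight, shiftRight, ih, motzkinWeight_eq_zero (show n < n + 1 by omega),
      motzkinWeight_eq_zero (show n < n + 1 + 1 by omega)]

/-- `P` is the sequence of monic polynomials with three-term recurrence
`x P_n = P_{n+1} + b_n P_n + l_n P_{n-1}`. -/
def IsThreeTerm (b l : ℕ → R) (P : ℕ → R[X]) : Prop :=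
  P 0 = 1 ∧ ∀ n, X * P n = P (n + 1) + C (b n) * P n + C (l n) * shiftRight P n

theorem sum_range_shiftRight_mul {S : Type*} [CommRing S] (v w : ℕ → S) (N : ℕ) :
    ∑ h ∈ Finset.range (N + 1), shiftRight v h * w h
      = ∑ h ∈ Finset.range N, v h * w (h + 1) := by
  rw [Finset.sum_range_succ']
  simp [shiftRight]

theorem sum_range_mul_shiftRight {S : Type*} [CommRing S] (v w : ℕ → S) (N : ℕ) :
    ∑ h ∈ Finset.range (N + 1), v h * shiftRight w h
      = ∑ h ∈ Finset.range N, v (h + 1) * w h := by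
  rw [Finset.sum_range_succ']
  simp [shiftRight]

/-- The recurrence of `motzkinWeight` is multiplication by x in the basis P_h: the coefficient at h
receives contributions from heights h - 1, h and h + 1. -/
theorem IsThreeTerm.X_pow_eq {P : ℕ → R[X]} (hP : IsThreeTerm b l P) (n : ℕ) :
    (X : R[X]) ^ n = ∑ h ∈ Finset.range (n + 1), C (motzkinWeight b l n h) * P h := by
  induction n with
  | zero => simp [motzkinWeight, hP.1]
  | succ n ih =>
    set T : ℕ → R := motzkinWeight b l n with hT
    have h0 : ∀ m, T (n + 1 + m) = 0 := fun m => motzkinWeight_eq_zero (by omega)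
    have hl : ∑ h ∈ Finset.range (n + 1 + 1), C (motzkinWeight b l (n + 1) h) * P h
        = (∑ h ∈ Finset.range (n + 1 + 1), shiftRight (fun i => C (T i)) h * P h)
          + (∑ h ∈ Finset.range (n + 1 + 1), C (T h) * (C (b h) * P h))
          + ∑ h ∈ Finset.range (n + 1 + 1), C (T (h + 1)) * (C (l (h + 1)) * P h) := by
      rw [← Finset.sum_add_distrib, ← Finset.sum_add_distrib]
      refine Finset.sum_congr rfl fun h _ => ?_
      have : shiftRight (fun i => C (T i)) h = C (shiftRight T h) := by
        cases h <;> simp [shiftRight]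
      rw [this]
      simp only [motzkinWeight, C_add, C_mul, ← hT]
      ring
    have hr : ∑ h ∈ Finset.range (n + 1), C (T (h + 1)) * (C (l (h + 1)) * P h)
        = ∑ h ∈ Finset.range (n + 1), C (T h) * (C (l h) * shiftRight P h) := by
      have h1 := sum_range_mul_shiftRight (fun h => C (T h) * C (l h)) P (n + 1)
      rw [Finset.sum_range_succ] at h1
      simp only [mul_assoc] at h1
      rw [← h1, show T (n + 1) = 0 from h0 0]
      simp
    rw [hl, sum_range_shiftRight_mul, Finset.sum_range_succ _ (n + 1),
      Finset.sum_range_succ (fun h => C (T (h + 1)) * _) (n + 1), hr,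
      show T (n + 1) = 0 from h0 0, show T (n + 1 + 1) = 0 from h0 1, pow_succ', ih,
      Finset.mul_sum]
    simp only [C_0, zero_mul, add_zero, ← Finset.sum_add_distrib]
    refine Finset.sum_congr rfl fun h _ => ?_
    rw [mul_left_comm, hP.2 h]
    ring

theorem IsThreeTerm.map_X_pow {P : ℕ → R[X]} (hP : IsThreeTerm b l P) {L : R[X] →ₗ[R] R}
    (hL : IsOrthogonalityFunctional P L) (n : ℕ) : L (X ^ n) = motzkinWeight b l n 0 := by
  have hz : ∀ h, L (P (h + 1)) = 0 := fun h => by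
    simpa [hP.1] using hL.map_mul_eq_zero (h + 1) 0 (by omega)
  rw [hP.X_pow_eq n, map_sum, Finset.sum_range_succ']
  simp only [← smul_eq_C_mul, map_smul, hz, hP.1, hL.map_one]
  simp

/-- The linear functional whose moments are the weights of Motzkin paths. -/
noncomputable def motzkinFunctional (b l : ℕ → R) : R[X] →ₗ[R] R :=
  (Polynomial.basisMonomials R).constr R fun n => motzkinWeight b l n 0

theorem motzkinFunctional_X_pow (n : ℕ) :
    motzkinFunctional b l (X ^ n) = motzkinWeight b l n 0 := by
  have h := (Polynomial.basisMonomials R).constr_basis R (fun n => motzkinWeight b l n 0) n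
  simp only [Polynomial.coe_basisMonomials, monomial_one_right_eq_X_pow] at h
  exact h

/-- x^n is P_n plus lower P_h, and the P_0 term alone already accounts for the moment; by induction
nothing is left for P_n when n > 0. -/
theorem IsThreeTerm.motzkinFunctional_apply {P : ℕ → R[X]} (hP : IsThreeTerm b l P) (n : ℕ) :
    motzkinFunctional b l (P n) = if n = 0 then 1 else 0 := by
  induction n using Nat.strong_induction_on with
  | _ n ih =>
    have h1 := motzkinFunctional_X_pow (b := b) (l := l) n
    rw [hP.X_pow_eq n, map_sum, Finset.sum_range_succ, motzkinWeight_self] at h1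
    rcases n with _ | n
    · simpa [motzkinWeight] using h1
    · rw [Finset.sum_range_succ', Finset.sum_eq_zero] at h1
      · simpa [← smul_eq_C_mul, ih 0 (by omega)] using h1
      · intro i hi
        rw [Finset.mem_range] at hi
        rw [← smul_eq_C_mul, map_smul, ih (i + 1) (by omega)]
        simp

/-- Expanding x P_m P_n by the recurrence of either factor expresses P_m P_{n+1} through products
with a smaller second index, which gives an induction on n for all m at once. -/
theorem IsThreeTerm.motzkinFunctional_mul {P : ℕ → R[X]} (hP : IsThreeTerm b l P) (m n : ℕ) :
    motzkinFunctional b l (P m * P n)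
      = if m = n then ∏ i ∈ Finset.range n, l (i + 1) else 0 := by
  induction n using Nat.strong_induction_on generalizing m with
  | _ n ih =>
    rcases n with _ | n
    · rw [hP.1, mul_one, hP.motzkinFunctional_apply]
      simp
    · have key : P m * P (n + 1) = P (m + 1) * P n + (b m - b n) • (P m * P n)
          + l m • (shiftRight P m * P n) - l n • (P m * shiftRight P n) := by
        simp only [smul_eq_C_mul, C_sub]
        linear_combination (P m) * (-hP.2 n) + (P n) * hP.2 m
      have hs : motzkinFunctional b l (shiftRight P m * P n)
          = if m = n + 1 then ∏ i ∈ Finset.range n, l (i + 1) else 0 := by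
        rcases m with _ | m
        · simp [shiftRight]
        · simp [shiftRight, ih n (by omega)]
      have ht : l n * motzkinFunctional b l (P m * shiftRight P n)
          = if m + 1 = n then ∏ i ∈ Finset.range n, l (i + 1) else 0 := by
        rcases n with _ | n
        · simp [shiftRight]
        · simp only [shiftRight, ih n (by omega), Finset.prod_range_succ, add_left_inj]
          split_ifs <;> ring
      rw [key]
      simp only [map_add, map_sub, map_smul, smul_eq_mul, hs, ht, ih n (by omega)]
      rcases eq_or_ne m (n + 1) with rfl | h1
      · simp [Finset.prod_range_succ]
        ring
      · rcases eq_or_ne m n with rfl | h2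
        · simp
        · simp [h1, h2]

theorem IsThreeTerm.isOrthogonalityFunctional [IsDomain R] {P : ℕ → R[X]}
    (hP : IsThreeTerm b l P) (hl : ∀ i, l (i + 1) ≠ 0) :
    IsOrthogonalityFunctional P (motzkinFunctional b l) where
  map_one := by simpa [hP.1] using hP.motzkinFunctional_apply 0
  map_mul_eq_zero m n hmn := by rw [hP.motzkinFunctional_mul, if_neg hmn]
  map_mul_self_ne_zero n := by
    rw [hP.motzkinFunctional_mul, if_pos rfl]
    exact Finset.prod_ne_zero_iff.mpr fun i _ => hl i

theorem IsThreeTerm.existsUnique_isOrthogonalityFunctional [IsDomain R] {P : ℕ → R[X]}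
    (hP : IsThreeTerm b l P) (hl : ∀ i, l (i + 1) ≠ 0) :
    ∃! L : R[X] →ₗ[R] R, IsOrthogonalityFunctional P L := by
  refine ⟨_, hP.isOrthogonalityFunctional hl, fun L hL => ?_⟩
  refine (Polynomial.basisMonomials R).ext fun n => ?_
  simp only [Polynomial.coe_basisMonomials, monomial_one_right_eq_X_pow]
  rw [hP.map_X_pow hL, motzkinFunctional_X_pow]

end Orthogonality

/-! ### Gaussian binomial coefficients -/

section GaussBinom

variable {R : Type*} [CommRing R]

/-- The Gaussian binomial coefficient, defined by the `q`-Pascal recurrence. -/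
def gaussBinom (q : R) : ℕ → ℕ → R
  | _, 0 => 1
  | 0, _ + 1 => 0
  | n + 1, k + 1 => gaussBinom q n k + q ^ (k + 1) * gaussBinom q n (k + 1)

variable (q : R)

@[simp] theorem gaussBinom_zero_right (n : ℕ) : gaussBinom q n 0 = 1 := by
  cases n <;> rfl

@[simp] theorem gaussBinom_zero_succ (k : ℕ) : gaussBinom q 0 (k + 1) = 0 := rfl

theorem gaussBinom_succ_succ (n k : ℕ) :
    gaussBinom q (n + 1) (k + 1) = gaussBinom q n k + q ^ (k + 1) * gaussBinom q n (k + 1) := rfl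

theorem gaussBinom_succ_left (n h : ℕ) :
    gaussBinom q (n + 1) h = shiftRight (gaussBinom q n) h + q ^ h * gaussBinom q n h := by
  cases h <;> simp [shiftRight, gaussBinom_succ_succ]

theorem gaussBinom_eq_zero {n k : ℕ} (h : n < k) : gaussBinom q n k = 0 := by
  induction n generalizing k with
  | zero =>
    obtain ⟨k, rfl⟩ : ∃ j, k = j + 1 := ⟨k - 1, by omega⟩
    rfl
  | succ n ih =>
    obtain ⟨k, rfl⟩ : ∃ j, k = j + 1 := ⟨k - 1, by omega⟩
    simp [gaussBinom_succ_succ, ih (show n < k by omega), ih (show n < k + 1 by omega)]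

theorem gaussBinom_self (n : ℕ) : gaussBinom q n n = 1 := by
  induction n with
  | zero => simp
  | succ n ih => simp [gaussBinom_succ_succ, ih, gaussBinom_eq_zero q (Nat.lt_succ_self n)]

/-- Ratio of neighbours in one row, with r in place of n - k and no division. The q-Pascal rule
reduces it to the same relation at smaller r and at smaller k, hence the double induction. -/
theorem gaussBinom_succ_right (k r : ℕ) :
    (1 - q ^ (k + 1)) * gaussBinom q (k + r) (k + 1) = (1 - q ^ r) * gaussBinom q (k + r) k := by
  induction r generalizing k with
  | zero => simp [gaussBinom_eq_zero q (Nat.lt_succ_self k)]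
  | succ r ihr =>
    induction k with
    | zero =>
      have h := ihr 0
      simp only [zero_add, gaussBinom_zero_right, pow_one, gaussBinom_succ_succ] at h ⊢
      linear_combination q * h
    | succ k ihk =>
      have h := ihr (k + 1)
      rw [show k + 1 + r = k + r + 1 by ring] at h
      rw [show k + (r + 1) = k + r + 1 by ring] at ihk
      rw [show k + 1 + (r + 1) = k + r + 1 + 1 by ring, gaussBinom_succ_succ q (k + r + 1) (k + 1),
        gaussBinom_succ_succ q (k + r + 1) k]
      linear_combination q ^ (k + 1 + 1) * h + ihk

theorem one_sub_mul_gaussBinom_succ_succ (n k : ℕ) :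
    (1 - q ^ (k + 1)) * gaussBinom q (n + 1) (k + 1) = (1 - q ^ (n + 1)) * gaussBinom q n k := by
  rcases lt_or_ge n k with h | h
  · simp [gaussBinom_eq_zero q h, gaussBinom_eq_zero q (show n + 1 < k + 1 by omega)]
  · obtain ⟨r, rfl⟩ := Nat.exists_eq_add_of_le h
    rw [gaussBinom_succ_succ]
    linear_combination q ^ (k + 1) * gaussBinom_succ_right q k r

theorem map_gaussBinom {S : Type*} [CommRing S] (f : R →+* S) (n k : ℕ) :
    gaussBinom (f q) n k = f (gaussBinom q n k) := by
  induction n generalizing k with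
  | zero => cases k <;> simp
  | succ n ih => cases k <;> simp [gaussBinom_succ_succ, ih]

theorem one_sub_mul_qInteger (n : ℕ) : (1 - q) * qInteger q n = 1 - q ^ n :=
  mul_neg_geom_sum q n

theorem qInteger_zero : qInteger q 0 = 0 := by simp [qInteger]

theorem map_qInteger {S : Type*} [CommRing S] (f : R →+* S) (n : ℕ) :
    qInteger (f q) n = f (qInteger q n) := by
  simp [qInteger]

/-- Splitting off the last factor of the product is the absorption identity
`one_sub_mul_gaussBinom_succ_succ`; the hypotheses permit the divisions. -/
theorem qBinomial_eq_gaussBinom {K : Type*} [Field K] {q : K} (hq : q ≠ 1)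
    (h : ∀ n, qInteger q (n + 1) ≠ 0) (n k : ℕ) : qBinomial q n k = gaussBinom q n k := by
  induction k generalizing n with
  | zero => simp [qBinomial]
  | succ k ih =>
    rcases n with _ | n
    · rw [gaussBinom_zero_succ, qBinomial]
      -- The first factor has index 0 + 1 - (k + 1), which is 0, and [0]_q = 0.
      refine Finset.prod_eq_zero (i := 1) (by simp) ?_
      simp [qInteger_zero]
    · have h1 : qBinomial q (n + 1) (k + 1)
          = qBinomial q n k * (qInteger q (n + 1) / qInteger q (k + 1)) := by
        rw [qBinomial, Finset.prod_Icc_succ_top (by omega), qBinomial]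
        congr 1
        · refine Finset.prod_congr rfl fun r _ => ?_
          rw [show n + 1 + r - (k + 1) = n + r - k by omega]
        · rw [show n + 1 + (k + 1) - (k + 1) = n + 1 by omega]
      have h2 := one_sub_mul_gaussBinom_succ_succ q n k
      rw [← one_sub_mul_qInteger, ← one_sub_mul_qInteger, mul_assoc, mul_assoc] at h2
      have h3 := mul_left_cancel₀ (sub_ne_zero.mpr hq.symm) h2
      rw [h1, ih, mul_div_assoc', div_eq_iff (h k), mul_comm, ← h3, mul_comm]

end GaussBinom

/-! ### Connection coefficients between constant and q-dependent weights -/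

section Connection

variable {R : Type*} [CommRing R] (q z : R)

/-- The summands of `connectionCoeff`. -/
def connectionTerm (m h j : ℕ) : R :=
  (-1) ^ (m + h + j) * q ^ (j + 1).choose 2 * gaussBinom q (m - j) j * gaussBinom q (m - 2 * j) h
    * z ^ j

/-- The coefficient of `P_h` in `U_m`, where `U` and `P` are the monic polynomials with
`x U_m = U_{m+1} + (1 + z) U_m + z U_{m-1}` and
`x P_h = P_{h+1} + (1 + z - q ^ h) P_h + z (1 - q ^ h) P_{h-1}`. -/
def connectionCoeff (m h : ℕ) : R :=
  ∑ j ∈ Finset.range (m + 1), connectionTerm q z m h j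

theorem connectionTerm_succ_zero (m h : ℕ) :
    connectionTerm q z (m + 1) h 0
      = shiftRight (fun i => connectionTerm q z m i 0) h - q ^ h * connectionTerm q z m h 0 := by
  simp only [connectionTerm, mul_zero, Nat.sub_zero, gaussBinom_succ_left]
  cases h with
  | zero => simp [shiftRight]; ring
  | succ h => simp [shiftRight]; ring

theorem connectionTerm_eq_zero {m h j : ℕ} (hj : m < 2 * j) : connectionTerm q z m h j = 0 := by
  simp [connectionTerm, gaussBinom_eq_zero q (show m - j < j by omega)]

theorem neg_one_pow_two_mul_add (a b : ℕ) : (-1 : R) ^ (2 * a + b) = (-1) ^ b := by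
  rw [pow_add, pow_mul]
  simp

/-- The recurrence of the connection coefficients already holds term by term, once the summation
index is shifted in the terms that carry z. It follows from the q-Pascal rule, absorption and the
neighbour ratio; the cases separate the range m ≤ 2j, where the truncated subtractions matter. -/
theorem connectionTerm_succ_succ (m h j : ℕ) :
    connectionTerm q z (m + 2) h (j + 1) + z * connectionTerm q z m h j
      = shiftRight (fun i => connectionTerm q z (m + 1) i (j + 1)) h
        - q ^ h * connectionTerm q z (m + 1) h (j + 1)
        + z * (1 - q ^ (h + 1)) * connectionTerm q z (m + 1) (h + 1) j := by
  have hc : (j + 1 + 1).choose 2 = (j + 1).choose 2 + (j + 1) := by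
    rw [Nat.choose_succ_succ' (j + 1) 1, Nat.choose_one_right, add_comm]
  rcases lt_trichotomy m (2 * j) with hm | rfl | hm
  · have hs : shiftRight (fun i => connectionTerm q z (m + 1) i (j + 1)) h = 0 := by
      cases h
      · rfl
      · exact connectionTerm_eq_zero q z (by omega)
    -- The term at height h + 1 need not have m + 1 < 2j; it vanishes because m + 1 - 2j = 0 and h +
    -- 1 > 0.
    rw [hs, connectionTerm_eq_zero q z (by omega), connectionTerm_eq_zero q z hm,
      connectionTerm_eq_zero q z (by omega), connectionTerm,
      show m + 1 - 2 * j = 0 by omega, gaussBinom_zero_succ]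
    simp
  · have hs : shiftRight (fun i => connectionTerm q z (2 * j + 1) i (j + 1)) h = 0 := by
      cases h
      · rfl
      · exact connectionTerm_eq_zero q z (by omega)
    have h1 := one_sub_mul_gaussBinom_succ_succ q 0 h
    have h2 := gaussBinom_succ_right q j 1
    rw [gaussBinom_self] at h2
    rw [hs, connectionTerm_eq_zero q z (show 2 * j + 1 < 2 * (j + 1) by omega)]
    simp only [connectionTerm, hc, show 2 * j + 2 - (j + 1) = j + 1 by omega,
      show 2 * j + 2 - 2 * (j + 1) = 0 by omega, show 2 * j - j = j by omega,
      show 2 * j - 2 * j = 0 by omega, show 2 * j + 1 - j = j + 1 by omega,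
      show 2 * j + 1 - 2 * j = 0 + 1 by omega, gaussBinom_self]
    rw [show 2 * j + 2 + h + (j + 1) = 2 * (j + 1) + (h + j + 1) by ring, neg_one_pow_two_mul_add,
      add_assoc (2 * j), neg_one_pow_two_mul_add,
      show 2 * j + 1 + (h + 1) + j = 2 * (j + 1) + (h + j) by ring, neg_one_pow_two_mul_add]
    linear_combination (-1) ^ (h + j) * q ^ (j + 1).choose 2 * z ^ (j + 1)
      * (gaussBinom q 0 h * h2 - gaussBinom q (j + 1) j * h1)
  · obtain ⟨p, rfl⟩ : ∃ p, m = 2 * j + 1 + p := ⟨m - (2 * j + 1), by omega⟩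
    have h1 := one_sub_mul_gaussBinom_succ_succ q (p + 1) h
    have h2 := gaussBinom_succ_right q j (p + 2)
    have h3 := gaussBinom_succ_succ q (j + 1 + p) j
    have h4 := gaussBinom_succ_left q p h
    have hs : shiftRight (fun i => connectionTerm q z (2 * j + 1 + p + 1) i (j + 1)) h
        = (-1) ^ (h + j + p) * q ^ (j + 1 + 1).choose 2 * gaussBinom q (j + 1 + p) (j + 1)
          * shiftRight (gaussBinom q p) h * z ^ (j + 1) := by
      cases h with
      | zero => simp [shiftRight]
      | succ h =>
        simp only [shiftRight, connectionTerm,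
          show 2 * j + 1 + p + 1 - (j + 1) = j + 1 + p by omega,
          show 2 * j + 1 + p + 1 - 2 * (j + 1) = p by omega]
        rw [show 2 * j + 1 + p + 1 + h + (j + 1) = 2 * (j + 1) + (h + 1 + j + p) by ring,
          neg_one_pow_two_mul_add]
    rw [hs]
    simp only [connectionTerm, hc, show 2 * j + 1 + p + 2 - (j + 1) = j + 1 + p + 1 by omega,
      show 2 * j + 1 + p + 2 - 2 * (j + 1) = p + 1 by omega,
      show 2 * j + 1 + p - j = j + 1 + p by omega,
      show 2 * j + 1 + p - 2 * j = p + 1 by omega,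
      show 2 * j + 1 + p + 1 - (j + 1) = j + 1 + p by omega,
      show 2 * j + 1 + p + 1 - 2 * (j + 1) = p by omega,
      show 2 * j + 1 + p + 1 - j = j + 1 + p + 1 by omega,
      show 2 * j + 1 + p + 1 - 2 * j = p + 1 + 1 by omega]
    rw [show j + (p + 2) = j + 1 + p + 1 by ring] at h2
    rw [show 2 * j + 1 + p + 2 + h + (j + 1) = 2 * (j + 2) + (h + j + p) by ring,
      neg_one_pow_two_mul_add, show 2 * j + 1 + p + h + j = 2 * j + (h + j + p + 1) by ring,
      neg_one_pow_two_mul_add,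
      show 2 * j + 1 + p + 1 + h + (j + 1) = 2 * (j + 1) + (h + j + p + 1) by ring,
      neg_one_pow_two_mul_add,
      show 2 * j + 1 + p + 1 + (h + 1) + j = 2 * (j + 1) + (h + j + p + 1) by ring,
      neg_one_pow_two_mul_add]
    linear_combination (-1) ^ (h + j + p) * q ^ (j + 1).choose 2 * z ^ (j + 1)
      * (q ^ (j + 1) * gaussBinom q (j + 1 + p) (j + 1) * h4 + gaussBinom q (j + 1 + p + 1) j * h1
        + gaussBinom q (p + 1) h * (h3 - h2))

theorem shiftRight_sum {ι : Type*} (s : Finset ι) (f : ℕ → ι → R) (h : ℕ) :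
    shiftRight (fun i => ∑ j ∈ s, f i j) h = ∑ j ∈ s, shiftRight (fun i => f i j) h := by
  cases h <;> simp [shiftRight]

theorem connectionCoeff_eq_sum_range {m N : ℕ} (h : ℕ) (hN : m < N) :
    connectionCoeff q z m h = ∑ j ∈ Finset.range N, connectionTerm q z m h j := by
  refine Finset.sum_subset (Finset.range_subset_range.mpr hN) fun j _ hj => ?_
  rw [Finset.mem_range, not_lt] at hj
  exact connectionTerm_eq_zero q z (by omega)

theorem connectionCoeff_zero_left (h : ℕ) : connectionCoeff q z 0 h = if h = 0 then 1 else 0 := by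
  cases h <;> simp [connectionCoeff, connectionTerm]

/-- This compares the coefficients of P_h in x U_m, computed by the recurrence of U and by that of
P; the common part 1 + z of the level weights cancels. -/
theorem connectionCoeff_succ (m h : ℕ) :
    connectionCoeff q z (m + 1) h + z * shiftRight (fun i => connectionCoeff q z i h) m
      = shiftRight (connectionCoeff q z m) h - q ^ h * connectionCoeff q z m h
        + z * (1 - q ^ (h + 1)) * connectionCoeff q z m (h + 1) := by
  rcases m with _ | m
  · have h1 : connectionCoeff q z 1 h = connectionTerm q z (0 + 1) h 0 := by
      rw [connectionCoeff, Finset.sum_range_succ, Finset.sum_range_one,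
        connectionTerm_eq_zero q z (show 0 + 1 < 2 * 1 by omega), add_zero]
    have h2 : ∀ i, connectionCoeff q z 0 i = connectionTerm q z 0 i 0 := fun i => by
      rw [connectionCoeff, zero_add, Finset.sum_range_one]
    have h3 : connectionCoeff q z 0 (h + 1) = 0 := by simp [connectionCoeff_zero_left]
    rw [h1, h3, connectionTerm_succ_zero, h2, show connectionCoeff q z 0 = _ from funext h2]
    simp [shiftRight]
  · have e1 : connectionCoeff q z (m + 1 + 1) h
        = connectionTerm q z (m + 1 + 1) h 0
          + ∑ j ∈ Finset.range (m + 2), connectionTerm q z (m + 2) h (j + 1) := by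
      rw [connectionCoeff, Finset.sum_range_succ', add_comm]
    have e2 : ∀ i, connectionCoeff q z (m + 1) i
        = connectionTerm q z (m + 1) i 0
          + ∑ j ∈ Finset.range (m + 2), connectionTerm q z (m + 1) i (j + 1) := fun i => by
      rw [connectionCoeff_eq_sum_range q z i (show m + 1 < m + 2 + 1 by omega),
        Finset.sum_range_succ', add_comm]
    have e3 : shiftRight (connectionCoeff q z (m + 1)) h
        = shiftRight (fun i => connectionTerm q z (m + 1) i 0) h
          + ∑ j ∈ Finset.range (m + 2),
              shiftRight (fun i => connectionTerm q z (m + 1) i (j + 1)) h := by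
      cases h <;> simp [shiftRight, e2]
    have e4 := connectionCoeff_eq_sum_range q z h (show m < m + 2 by omega)
    have e5 : connectionCoeff q z (m + 1) (h + 1) = ∑ j ∈ Finset.range (m + 2), _ := rfl
    have key := Finset.sum_congr (rfl : Finset.range (m + 2) = _)
      fun j _ => connectionTerm_succ_succ q z m h j
    rw [Finset.sum_add_distrib, Finset.sum_add_distrib, Finset.sum_sub_distrib,
      ← Finset.mul_sum, ← Finset.mul_sum, ← Finset.mul_sum, ← e4, ← e5] at key
    rw [e1, e3, e2 h]
    rw [show shiftRight (fun i => connectionCoeff q z i h) (m + 1) = connectionCoeff q z m h from rfl]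
    linear_combination key + connectionTerm_succ_zero q z (m + 1) h

end Connection

/-! ### Motzkin prefixes with constant weights -/

section Ballot

variable {R : Type*} [CommRing R] (z : R)

/-- The coefficients of `ballotSum`. -/
def ballotCoeff (R : Type*) [CommRing R] (n m k : ℕ) : R :=
  (n.choose (k + m) : R) * (n.choose k : R)
    - (n.choose (k + m + 1) : R) * shiftRight (fun i => (n.choose i : R)) k

/-- The total weight of the Motzkin prefixes of length `n` ending at height `m`, where up steps
have weight `1`, level steps `1 + z` and down steps `z`. -/
def ballotSum (n m : ℕ) : R :=
  ∑ k ∈ Finset.range (n + 1), z ^ k * ballotCoeff R n m k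

theorem ballotCoeff_eq_zero {n m k : ℕ} (h : n < k + m) : ballotCoeff R n m k = 0 := by
  simp [ballotCoeff, Nat.choose_eq_zero_of_lt h,
    Nat.choose_eq_zero_of_lt (show n < k + m + 1 by omega)]

theorem ballotSum_eq_zero {n m : ℕ} (h : n < m) : ballotSum z n m = 0 :=
  Finset.sum_eq_zero fun k _ => by rw [ballotCoeff_eq_zero (by omega), mul_zero]

theorem cast_choose_succ (n k : ℕ) :
    ((n + 1).choose k : R) = shiftRight (fun i => (n.choose i : R)) k + n.choose k := by
  cases k <;> simp [shiftRight, Nat.choose_succ_succ']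

theorem ballotCoeff_succ_zero (n m : ℕ) :
    ballotCoeff R (n + 1) m 0
      = shiftRight (fun i => ballotCoeff R n i 0) m + ballotCoeff R n m 0 := by
  cases m <;> simp [ballotCoeff, shiftRight, Nat.choose_succ_succ']

/-- The step polynomial x + (1 + z) + z/x factors as (1 + x)(1 + z/x), so unrestricted paths are
counted by products of two binomials and Pascal's rule applies to each. The subtracted product makes
the expression vanish at height -1, which settles m = 0. -/
theorem ballotCoeff_succ_succ (n m k : ℕ) :
    ballotCoeff R (n + 1) m (k + 1)
      = shiftRight (fun i => ballotCoeff R n i (k + 1)) m + ballotCoeff R n m (k + 1)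
        + ballotCoeff R n m k + ballotCoeff R n (m + 1) k := by
  cases m with
  | zero =>
    simp only [ballotCoeff, shiftRight, cast_choose_succ, add_zero,
      show k + (0 + 1) = k + 1 by ring]
    ring
  | succ m =>
    simp only [ballotCoeff, shiftRight, cast_choose_succ,
      show k + 1 + (m + 1) = k + m + 1 + 1 by ring, show k + 1 + m = k + m + 1 by ring,
      show k + (m + 1) = k + m + 1 by ring, show k + (m + 1 + 1) = k + m + 1 + 1 by ring]
    ring

theorem ballotSum_zero_left (m : ℕ) : ballotSum z 0 m = if m = 0 then 1 else 0 := by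
  cases m <;> simp [ballotSum, ballotCoeff, shiftRight]

theorem ballotSum_succ (n m : ℕ) :
    ballotSum z (n + 1) m
      = shiftRight (ballotSum z n) m + (1 + z) * ballotSum z n m
        + z * ballotSum z n (m + 1) := by
  have e : ∀ i, ballotSum z n i = ballotCoeff R n i 0
      + ∑ k ∈ Finset.range (n + 1), z ^ (k + 1) * ballotCoeff R n i (k + 1) := fun i => by
    have h := Finset.sum_range_succ (fun k => z ^ k * ballotCoeff R n i k) (n + 1)
    rw [ballotCoeff_eq_zero (show n < n + 1 + i by omega), mul_zero, add_zero,
      Finset.sum_range_succ'] at h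
    rw [ballotSum, ← h, pow_zero, one_mul, add_comm]
  have es : shiftRight (ballotSum z n) m = shiftRight (fun i => ballotCoeff R n i 0) m
      + ∑ k ∈ Finset.range (n + 1),
          z ^ (k + 1) * shiftRight (fun i => ballotCoeff R n i (k + 1)) m := by
    cases m <;> simp [shiftRight, e]
  have e1 : ballotSum z (n + 1) m = ballotCoeff R (n + 1) m 0
      + ∑ k ∈ Finset.range (n + 1), z ^ (k + 1) * ballotCoeff R (n + 1) m (k + 1) := by
    rw [ballotSum, Finset.sum_range_succ', pow_zero, one_mul, add_comm]
  have e2 : ∀ i, z * ballotSum z n i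
      = ∑ k ∈ Finset.range (n + 1), z ^ (k + 1) * ballotCoeff R n i k := fun i => by
    rw [ballotSum, Finset.mul_sum]
    exact Finset.sum_congr rfl fun k _ => by ring
  rw [add_mul, one_mul, e2, e2, es, e m, e1, ballotCoeff_succ_zero]
  simp only [ballotCoeff_succ_succ, mul_add, Finset.sum_add_distrib]
  ring

/-- Both sides are the coefficient of P_h in x^n; on the right x^n is first expanded in the U_m. In
the induction, summation by parts moves the step from `ballotSum` to `connectionCoeff`. -/
theorem motzkinWeight_eq_sum_ballotSum_mul_connectionCoeff (q : R) (n h : ℕ) :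
    motzkinWeight (fun i => 1 + z - q ^ i) (fun i => z * (1 - q ^ i)) n h
      = ∑ m ∈ Finset.range (n + 1), ballotSum z n m * connectionCoeff q z m h := by
  induction n generalizing h with
  | zero => simp [motzkinWeight, ballotSum_zero_left, connectionCoeff_zero_left]
  | succ n ih =>
    have hD : ∀ i, ballotSum z n (n + 1 + i) = 0 := fun i => ballotSum_eq_zero z (by omega)
    have hs : shiftRight (motzkinWeight (fun i => 1 + z - q ^ i) (fun i => z * (1 - q ^ i)) n) h
        = ∑ m ∈ Finset.range (n + 1), ballotSum z n m * shiftRight (connectionCoeff q z m) h := by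
      cases h <;> simp [shiftRight, ih]
    have h1 := sum_range_shiftRight_mul (ballotSum z n) (fun m => connectionCoeff q z m h) (n + 1)
    have h2 := sum_range_mul_shiftRight (ballotSum z n) (fun m => connectionCoeff q z m h) (n + 1)
    rw [Finset.sum_range_succ, show ballotSum z n (n + 1) = 0 from hD 0, zero_mul, add_zero] at h2
    rw [motzkinWeight, hs, ih, ih]
    have h3 : ∑ m ∈ Finset.range (n + 1 + 1), ballotSum z (n + 1) m * connectionCoeff q z m h
        = (∑ m ∈ Finset.range (n + 1 + 1), shiftRight (ballotSum z n) m * connectionCoeff q z m h)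
          + (1 + z) * (∑ m ∈ Finset.range (n + 1 + 1), ballotSum z n m * connectionCoeff q z m h)
          + z * ∑ m ∈ Finset.range (n + 1 + 1),
              ballotSum z n (m + 1) * connectionCoeff q z m h := by
      rw [Finset.mul_sum, Finset.mul_sum, ← Finset.sum_add_distrib, ← Finset.sum_add_distrib]
      exact Finset.sum_congr rfl fun m _ => by rw [ballotSum_succ]; ring
    rw [h3, h1, Finset.sum_range_succ (fun m => ballotSum z n m * connectionCoeff q z m h) (n + 1),
      Finset.sum_range_succ (fun m => ballotSum z n (m + 1) * connectionCoeff q z m h) (n + 1),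
      show ballotSum z n (n + 1) = 0 from hD 0, show ballotSum z n (n + 1 + 1) = 0 from hD 1, ← h2]
    simp only [zero_mul, add_zero, Finset.mul_sum, ← Finset.sum_add_distrib]
    refine Finset.sum_congr rfl fun m _ => ?_
    linear_combination (-ballotSum z n m) * connectionCoeff_succ q z m h

end Ballot

/-! ### The closed formula for the path weights -/

section ClosedFormula

open Polynomial

/-- Rescaling multiplies a level weight by 1 - q and a down weight by (1 - q)^2. In a prefix from 0
to h the level steps plus twice the down steps number n - h; the factor (1 - q)^h avoids this
subtraction. -/
theorem one_sub_pow_mul_motzkinWeight {R : Type*} [CommRing R] (q y : R) (n h : ℕ) :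
    (1 - q) ^ n * motzkinWeight (fun i => y + qInteger q i) (fun i => y * qInteger q i) n h
      = (1 - q) ^ h * motzkinWeight (fun i => 1 + (1 - q) * y - q ^ i)
          (fun i => (1 - q) * y * (1 - q ^ i)) n h := by
  induction n generalizing h with
  | zero => by_cases hh : h = 0 <;> simp [motzkinWeight, hh]
  | succ n ih =>
    have h1 := one_sub_mul_qInteger q h
    have h2 := one_sub_mul_qInteger q (h + 1)
    have h3 : (1 - q) ^ (n + 1)
          * shiftRight (motzkinWeight (fun i => y + qInteger q i) (fun i => y * qInteger q i) n) h
        = (1 - q) ^ h * shiftRight (motzkinWeight (fun i => 1 + (1 - q) * y - q ^ i)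
          (fun i => (1 - q) * y * (1 - q ^ i)) n) h := by
      cases h with
      | zero => simp [shiftRight]
      | succ h =>
        simp only [shiftRight]
        linear_combination (1 - q) * ih h
    simp only [motzkinWeight]
    linear_combination h3 + (1 - q) * (y + qInteger q h) * ih h
      + (1 - q) * y * qInteger q (h + 1) * ih (h + 1)
      + (1 - q) ^ h * motzkinWeight (fun i => 1 + (1 - q) * y - q ^ i)
          (fun i => (1 - q) * y * (1 - q ^ i)) n h * h1
      + (1 - q) ^ h * ((1 - q) * y) * motzkinWeight (fun i => 1 + (1 - q) * y - q ^ i)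
          (fun i => (1 - q) * y * (1 - q ^ i)) n (h + 1) * h2

/-- The numerator of `charlierFormula`. -/
def charlierNumerator {R : Type*} [CommRing R] (q : R) (n k : ℕ) : R :=
  ∑ j ∈ Finset.range (k + 1), ∑ i ∈ Finset.Icc j (n - k),
    (-1) ^ i * ballotCoeff R n (i + j) (k - j) * gaussBinom q i j * q ^ (j + 1).choose 2

theorem map_ballotCoeff {R S : Type*} [CommRing R] [CommRing S] (f : R →+* S) (n m k : ℕ) :
    ballotCoeff S n m k = f (ballotCoeff R n m k) := by
  cases k <;> simp [ballotCoeff, shiftRight]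

theorem map_charlierNumerator {R S : Type*} [CommRing R] [CommRing S] (f : R →+* S) (q : R)
    (n k : ℕ) : charlierNumerator (f q) n k = f (charlierNumerator q n k) := by
  simp [charlierNumerator, map_gaussBinom, map_ballotCoeff f]

theorem charlierNumerator_eq {R : Type*} [CommRing R] (q : R) {n k : ℕ} (hk : k ≤ n) :
    charlierNumerator q n k = ∑ j ∈ Finset.range (k + 1), ∑ i ∈ Finset.range (n + 1),
      (-1) ^ i * ballotCoeff R n (i + j) (k - j) * gaussBinom q i j * q ^ (j + 1).choose 2 := by
  refine Finset.sum_congr rfl fun j hj => Finset.sum_subset (fun i hi => ?_) fun i _ hi => ?_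
  · simp only [Finset.mem_Icc, Finset.mem_range] at hi ⊢
    omega
  · simp only [Finset.mem_Icc, Finset.mem_range] at hi hj
    rcases lt_or_ge i j with h | h
    · simp [gaussBinom_eq_zero q h]
    · simp [ballotCoeff_eq_zero (R := R) (show n < k - j + (i + j) by omega)]

/-- The substitution m = i + j turns the sign (-1)^(m+j) into (-1)^i, and replacing k by k - j
collects the total power of z. -/
theorem sum_ballotSum_mul_connectionCoeff {R : Type*} [CommRing R] (q z : R) (n : ℕ) :
    ∑ m ∈ Finset.range (n + 1), ballotSum z n m * connectionCoeff q z m 0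
      = ∑ k ∈ Finset.range (n + 1), z ^ k * charlierNumerator q n k := by
  set G : ℕ → ℕ → ℕ → R := fun j i k =>
    z ^ (k + j) * ((-1) ^ i * ballotCoeff R n (i + j) k * gaussBinom q i j
      * q ^ (j + 1).choose 2) with hG
  have hG0 : ∀ j i k, n < k + (i + j) → G j i k = 0 := fun j i k h => by
    simp [hG, ballotCoeff_eq_zero (R := R) h]
  have h1 : ∀ m ∈ Finset.range (n + 1), ballotSum z n m * connectionCoeff q z m 0
      = ∑ j ∈ Finset.range (m + 1), ∑ k ∈ Finset.range (n + 1), G j (m - j) k := fun m _ => by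
    rw [ballotSum, connectionCoeff, Finset.mul_sum]
    refine Finset.sum_congr rfl fun j hj => ?_
    rw [Finset.sum_mul]
    refine Finset.sum_congr rfl fun k _ => ?_
    have hj' : j ≤ m := Nat.lt_succ_iff.mp (Finset.mem_range.mp hj)
    simp only [hG, connectionTerm, gaussBinom_zero_right, Nat.sub_add_cancel hj']
    rw [show m + 0 + j = 2 * j + (m - j) by omega, neg_one_pow_two_mul_add]
    ring
  have h2 : ∀ k ∈ Finset.range (n + 1), z ^ k * charlierNumerator q n k
      = ∑ j ∈ Finset.range (k + 1), ∑ i ∈ Finset.range (n + 1), G j i (k - j) := fun k hk => by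
    rw [charlierNumerator_eq q (Nat.lt_succ_iff.mp (Finset.mem_range.mp hk)), Finset.mul_sum]
    refine Finset.sum_congr rfl fun j hj => ?_
    rw [Finset.mul_sum]
    refine Finset.sum_congr rfl fun i _ => ?_
    have hj' : j ≤ k := Nat.lt_succ_iff.mp (Finset.mem_range.mp hj)
    simp only [hG, Nat.sub_add_cancel hj']
  rw [Finset.sum_congr rfl h1, Finset.sum_congr rfl h2,
    Finset.sum_range_diag_flip (n + 1) fun j i => ∑ k ∈ Finset.range (n + 1), G j i k,
    Finset.sum_range_diag_flip (n + 1) fun j k => ∑ i ∈ Finset.range (n + 1), G j i k]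
  -- With j outermost, both triangular inner ranges extend to the full square, as the ballot
  -- coefficient vanishes outside.
  have hsub : ∀ j, Finset.range (n + 1 - j) ⊆ Finset.range (n + 1) := fun j =>
    Finset.range_subset_range.mpr (by omega)
  refine Finset.sum_congr rfl fun j _ => ?_
  rw [Finset.sum_subset (hsub j) (f := fun i => ∑ k ∈ Finset.range (n + 1), G j i k),
    Finset.sum_subset (hsub j) (f := fun k => ∑ i ∈ Finset.range (n + 1), G j i k),
    Finset.sum_comm]
  · intro k _ hk
    rw [Finset.mem_range] at hk
    exact Finset.sum_eq_zero fun i _ => hG0 j i k (by omega)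
  · intro i _ hi
    rw [Finset.mem_range] at hi
    exact Finset.sum_eq_zero fun k _ => hG0 j i k (by omega)

/-- As j ≤ k, only the lower index k - j - 1 can be negative, namely for j = k; there `shiftRight`
has its initial 0. -/
theorem cast_binomialInt_sub {K : Type*} [Field K] {n i j k : ℕ} (hj : j ≤ k) :
    ((binomialInt n ((k : ℤ) + i) * binomialInt n ((k : ℤ) - j)
      - binomialInt n ((k : ℤ) + i + 1) * binomialInt n ((k : ℤ) - j - 1) : ℤ) : K)
      = ballotCoeff K n (i + j) (k - j) := by
  have h1 : binomialInt n ((k : ℤ) + i) = n.choose (k - j + (i + j)) := by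
    rw [binomialInt, if_pos (by omega)]; congr 2; omega
  have h2 : binomialInt n ((k : ℤ) - j) = n.choose (k - j) := by
    rw [binomialInt, if_pos (by omega)]; congr 2; omega
  have h3 : binomialInt n ((k : ℤ) + i + 1) = n.choose (k - j + (i + j) + 1) := by
    rw [binomialInt, if_pos (by omega)]; congr 2; omega
  have h4 : (binomialInt n ((k : ℤ) - j - 1) : K)
      = shiftRight (fun i => (n.choose i : K)) (k - j) := by
    rcases h : k - j with _ | r
    · rw [binomialInt, if_neg (by omega)]
      simp [shiftRight]
    · rw [binomialInt, if_pos (by omega), show ((k : ℤ) - j - 1).toNat = r by omega]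
      simp [shiftRight]
  simp only [Int.cast_sub, Int.cast_mul, h4, h1, h2, h3, Int.cast_natCast, ballotCoeff]

variable {K : Type*} [Field K] {q : K}

theorem charlierFormula_eq (hq : q ≠ 1) (hqi : ∀ n, qInteger q (n + 1) ≠ 0) (n k : ℕ) :
    (1 - q) ^ n * charlierFormula q n k = (1 - q) ^ k * charlierNumerator q n k := by
  have hq' : 1 - q ≠ 0 := sub_ne_zero.mpr hq.symm
  have h1 : charlierFormula q n k = 1 / (1 - q) ^ ((n : ℤ) - (k : ℤ)) * charlierNumerator q n k := by
    rw [charlierFormula, charlierNumerator]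
    congr 1
    refine Finset.sum_congr rfl fun j hj => Finset.sum_congr rfl fun i _ => ?_
    rw [cast_binomialInt_sub (Nat.lt_succ_iff.mp (Finset.mem_range.mp hj)),
      qBinomial_eq_gaussBinom hq hqi]
  rw [h1, zpow_sub₀ hq', zpow_natCast, zpow_natCast]
  field_simp

theorem charlierFormula_eq_zero {n k : ℕ} (hk : n < k) : charlierFormula q n k = 0 := by
  rw [charlierFormula, Finset.sum_eq_zero, mul_zero]
  refine fun j hj => Finset.sum_eq_zero fun i _ => ?_
  rw [cast_binomialInt_sub (Nat.lt_succ_iff.mp (Finset.mem_range.mp hj))]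
  have hj' : j ≤ k := Nat.lt_succ_iff.mp (Finset.mem_range.mp hj)
  simp [ballotCoeff_eq_zero (R := K) (show n < k - j + (i + j) by omega)]

theorem motzkinWeight_eq_sum_charlierFormula (hq : q ≠ 1) (hqi : ∀ n, qInteger q (n + 1) ≠ 0)
    (n : ℕ) :
    motzkinWeight (fun i => (X : K[X]) + qInteger (C q) i) (fun i => X * qInteger (C q) i) n 0
      = ∑ k ∈ Finset.range (n + 1), C (charlierFormula q n k) * X ^ k := by
  have hq' : (1 - C q : K[X]) ≠ 0 := by
    rw [← C_1, ← C_sub, Ne, C_eq_zero]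
    exact sub_ne_zero.mpr hq.symm
  refine mul_left_cancel₀ (pow_ne_zero n hq') ?_
  rw [one_sub_pow_mul_motzkinWeight, motzkinWeight_eq_sum_ballotSum_mul_connectionCoeff,
    sum_ballotSum_mul_connectionCoeff, pow_zero, one_mul, Finset.mul_sum]
  refine Finset.sum_congr rfl fun k _ => ?_
  have h := congrArg C (charlierFormula_eq hq hqi n k)
  simp only [C_mul, C_pow, C_sub, C_1] at h
  rw [map_charlierNumerator C q, ← mul_assoc, h, mul_pow]
  ring

end ClosedFormula

/-! ### The recurrence of the q-Charlier polynomials -/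

section QCharlier

open Polynomial

theorem qCharlier_isThreeTerm {R : Type*} [CommRing R] (q y : R) :
    IsThreeTerm (fun i => y + qInteger q i) (fun i => y * qInteger q i) (qCharlier q y) := by
  refine ⟨rfl, fun n => ?_⟩
  rcases n with _ | n
  · simp [qCharlier, shiftRight, qInteger_zero]
  · simp only [qCharlier, shiftRight]
    ring

end QCharlier

/-! ### Inserting the largest element into a set partition -/

section Arcs

theorem mem_setPartitionArcs {n : ℕ} {π : Finpartition (Finset.Icc 1 n)} {i j : ℕ} :
    (i, j) ∈ setPartitionArcs π ↔
      i < j ∧ ∃ B ∈ π.parts, i ∈ B ∧ j ∈ B ∧ ∀ m ∈ B, ¬(i < m ∧ m < j) := by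
  rw [setPartitionArcs, Finset.mem_filter, Finset.mem_product]
  refine ⟨fun h => h.2, fun h => ⟨?_, h⟩⟩
  obtain ⟨-, B, hB, hi, hj, -⟩ := h
  exact ⟨π.subset hB hi, π.subset hB hj⟩

theorem le_of_mem_setPartitionArcs {n : ℕ} {π : Finpartition (Finset.Icc 1 n)} {x : ℕ × ℕ}
    (hx : x ∈ setPartitionArcs π) : x.1 < x.2 ∧ x.2 ≤ n := by
  obtain ⟨i, j⟩ := x
  obtain ⟨hij, B, hB, -, hj, -⟩ := mem_setPartitionArcs.mp hx
  exact ⟨hij, (Finset.mem_Icc.mp (π.subset hB hj)).2⟩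

theorem le_of_mem_part {n : ℕ} {π : Finpartition (Finset.Icc 1 n)} {B : Finset ℕ}
    (hB : B ∈ π.parts) {m : ℕ} (hm : m ∈ B) : m ≤ n :=
  (Finset.mem_Icc.mp (π.subset hB hm)).2

/-- The partition of `{1, …, n + 1}` obtained from `π` by adding `n + 1` to the block `C`, or as a
new block if `C` is empty. -/
def Finpartition.addLast {n : ℕ} (π : Finpartition (Finset.Icc 1 n)) (C : Finset ℕ)
    (hC : C ∈ insert ∅ π.parts) : Finpartition (Finset.Icc 1 (n + 1)) :=
  Finpartition.ofExistsUnique (insert (insert (n + 1) C) (π.parts.erase C))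
    (by
      intro p hp m hm
      rw [Finset.mem_Icc]
      rcases Finset.mem_insert.mp hp with rfl | hp
      · rcases Finset.mem_insert.mp hm with rfl | hm
        · omega
        · rcases Finset.mem_insert.mp hC with rfl | hC
          · simp at hm
          · have := Finset.mem_Icc.mp (π.subset hC hm)
            omega
      · have := Finset.mem_Icc.mp (π.subset (Finset.mem_of_mem_erase hp) hm)
        omega)
    (by
      intro a ha
      rcases eq_or_ne a (n + 1) with rfl | hne
      · refine ⟨insert (n + 1) C, ⟨by simp, by simp⟩, ?_⟩
        rintro t ⟨ht, hat⟩
        rcases Finset.mem_insert.mp ht with rfl | ht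
        · rfl
        · have := le_of_mem_part (Finset.mem_of_mem_erase ht) hat
          omega
      · have ha' : a ∈ Finset.Icc 1 n := by
          rw [Finset.mem_Icc] at ha ⊢
          omega
        obtain ⟨t, ⟨ht, hat⟩, huniq⟩ := π.existsUnique_mem ha'
        have hmemC : a ∈ C → C = t := fun h => by
          rcases Finset.mem_insert.mp hC with rfl | hC
          · simp at h
          · exact huniq C ⟨hC, h⟩
        by_cases htC : t = C
        · subst htC
          refine ⟨insert (n + 1) t, ⟨by simp, by simp [hat]⟩, ?_⟩
          rintro u ⟨hu, hau⟩
          rcases Finset.mem_insert.mp hu with rfl | hu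
          · rfl
          · exact absurd (huniq u ⟨Finset.mem_of_mem_erase hu, hau⟩) (Finset.ne_of_mem_erase hu)
        · refine ⟨t, ⟨Finset.mem_insert_of_mem (Finset.mem_erase.mpr ⟨htC, ht⟩), hat⟩, ?_⟩
          rintro u ⟨hu, hau⟩
          rcases Finset.mem_insert.mp hu with rfl | hu
          · exact absurd (hmemC (Finset.mem_of_mem_insert_of_ne hau hne)).symm htC
          · exact huniq u ⟨Finset.mem_of_mem_erase hu, hau⟩)
    (by
      intro h
      rcases Finset.mem_insert.mp h with h | h
      · exact (Finset.insert_ne_empty _ _) h.symm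
      · exact π.empty_notMem_parts (Finset.mem_of_mem_erase h))

theorem Finpartition.parts_addLast {n : ℕ} (π : Finpartition (Finset.Icc 1 n)) (C : Finset ℕ)
    (hC : C ∈ insert ∅ π.parts) :
    (π.addLast C hC).parts = insert (insert (n + 1) C) (π.parts.erase C) := rfl

/-- The partition of `{1, …, n}` obtained by removing `n + 1`. -/
def Finpartition.removeLast {n : ℕ} (π : Finpartition (Finset.Icc 1 (n + 1))) :
    Finpartition (Finset.Icc 1 n) :=
  (π.avoid {n + 1}).copy (by ext m; simp; omega)

theorem Finpartition.mem_parts_removeLast {n : ℕ} {π : Finpartition (Finset.Icc 1 (n + 1))}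
    {c : Finset ℕ} : c ∈ π.removeLast.parts ↔
      c ≠ ∅ ∧ ∃ d ∈ π.parts, d.erase (n + 1) = c := by
  change c ∈ (π.avoid {n + 1}).parts ↔ _
  rw [Finpartition.mem_avoid]
  constructor
  · rintro ⟨d, hd, hne, rfl⟩
    rw [← Finset.sdiff_eq_empty_iff_subset] at hne
    exact ⟨hne, d, hd, (Finset.sdiff_singleton_eq_erase _ _).symm⟩
  · rintro ⟨hne, d, hd, rfl⟩
    refine ⟨d, hd, ?_, Finset.sdiff_singleton_eq_erase _ _⟩
    rwa [← Finset.sdiff_eq_empty_iff_subset,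
      Finset.sdiff_singleton_eq_erase]

theorem Finpartition.part_addLast {n : ℕ} (π : Finpartition (Finset.Icc 1 n)) (C : Finset ℕ)
    (hC : C ∈ insert ∅ π.parts) : (π.addLast C hC).part (n + 1) = insert (n + 1) C :=
  Finpartition.part_eq_of_mem _ (by simp [parts_addLast]) (by simp)

theorem succ_notMem_of_mem {n : ℕ} {π : Finpartition (Finset.Icc 1 n)} {C : Finset ℕ}
    (hC : C ∈ insert ∅ π.parts) : n + 1 ∉ C := by
  rcases Finset.mem_insert.mp hC with rfl | hC
  · simp
  · intro h
    have := le_of_mem_part hC h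
    omega

theorem Finpartition.removeLast_addLast {n : ℕ} (π : Finpartition (Finset.Icc 1 n))
    (C : Finset ℕ) (hC : C ∈ insert ∅ π.parts) : (π.addLast C hC).removeLast = π := by
  have hnC := succ_notMem_of_mem hC
  ext c
  rw [mem_parts_removeLast, parts_addLast]
  constructor
  · rintro ⟨hne, d, hd, rfl⟩
    rcases Finset.mem_insert.mp hd with rfl | hd
    · rw [Finset.erase_insert hnC] at hne ⊢
      exact Finset.mem_of_mem_insert_of_ne hC hne
    · have hd' := Finset.mem_of_mem_erase hd
      rwa [Finset.erase_eq_of_notMem (succ_notMem_of_mem (Finset.mem_insert_of_mem hd'))]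
  · intro hc
    refine ⟨π.ne_empty hc, ?_⟩
    by_cases h : c = C
    · exact ⟨insert (n + 1) C, by simp, by rw [Finset.erase_insert hnC, h]⟩
    · exact ⟨c, by simp [h, hc],
        Finset.erase_eq_of_notMem (succ_notMem_of_mem (Finset.mem_insert_of_mem hc))⟩

theorem Finpartition.erase_part_mem {n : ℕ} (π : Finpartition (Finset.Icc 1 (n + 1))) :
    (π.part (n + 1)).erase (n + 1) ∈ insert ∅ π.removeLast.parts := by
  rw [Finset.mem_insert, or_iff_not_imp_left]
  intro h
  exact mem_parts_removeLast.mpr ⟨h, _, π.part_mem.mpr (by simp), rfl⟩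

theorem Finpartition.addLast_removeLast {n : ℕ} (π : Finpartition (Finset.Icc 1 (n + 1))) :
    π.removeLast.addLast _ π.erase_part_mem = π := by
  have hmem : n + 1 ∈ π.part (n + 1) := π.mem_part_self.mpr (by simp)
  have hpart : π.part (n + 1) ∈ π.parts := π.part_mem.mpr (by simp)
  have hnot : ∀ d ∈ π.parts, d ≠ π.part (n + 1) → d.erase (n + 1) = d := fun d hd hne =>
    Finset.erase_eq_of_notMem fun h => hne (π.eq_of_mem_parts hd hpart h hmem)
  ext t
  rw [parts_addLast, Finset.insert_erase hmem, Finset.mem_insert, Finset.mem_erase,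
    mem_parts_removeLast]
  constructor
  · rintro (rfl | ⟨hne, -, d, hd, rfl⟩)
    · exact hpart
    · rw [hnot d hd (fun h => hne (by rw [h]))]
      exact hd
  · intro ht
    by_cases h : t = π.part (n + 1)
    · exact Or.inl h
    · refine Or.inr ⟨fun h' => ?_, π.ne_empty ht, t, ht, hnot t ht h⟩
      obtain ⟨m, hm⟩ := π.nonempty_of_mem_parts ht
      exact h (π.eq_of_mem_parts ht hpart hm (Finset.mem_of_mem_erase (h' ▸ hm)))

/-- A partition of {1, …, n + 1} is determined by its restriction and by the rest of the block of n
+ 1, which is empty when n + 1 is a singleton. -/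
theorem sum_finpartition_Icc_succ {M : Type*} [AddCommMonoid M] (n : ℕ)
    (F : Finpartition (Finset.Icc 1 (n + 1)) → M) :
    ∑ π, F π = ∑ π : Finpartition (Finset.Icc 1 n),
      ∑ C ∈ (insert ∅ π.parts).attach, F (π.addLast C.1 C.2) := by
  -- A total summand, with default value 0, frees the sum from membership proofs so that the
  -- bijection runs over plain pairs.
  have h : ∀ π : Finpartition (Finset.Icc 1 n),
      ∑ C ∈ (insert ∅ π.parts).attach, F (π.addLast C.1 C.2)
        = ∑ C ∈ insert ∅ π.parts,
          if hC : C ∈ insert ∅ π.parts then F (π.addLast C hC) else 0 := fun π => by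
    rw [← Finset.sum_attach (insert ∅ π.parts)]
    exact Finset.sum_congr rfl fun C _ => by rw [dif_pos C.2]
  simp only [h]
  rw [Finset.sum_sigma']
  refine Finset.sum_bij' (fun π _ => ⟨π.removeLast, (π.part (n + 1)).erase (n + 1)⟩)
    (fun x hx => x.1.addLast x.2 (Finset.mem_sigma.mp hx).2) ?_ ?_ ?_ ?_ ?_
  · exact fun π _ => Finset.mem_sigma.mpr ⟨Finset.mem_univ _, π.erase_part_mem⟩
  · exact fun _ _ => Finset.mem_univ _
  · exact fun π _ => π.addLast_removeLast
  · rintro ⟨π, C⟩ hx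
    have hC := (Finset.mem_sigma.mp hx).2
    simp only at hC
    simp only [Finpartition.removeLast_addLast, Finpartition.part_addLast,
      Finset.erase_insert (succ_notMem_of_mem hC)]
  · intro π _
    rw [dif_pos π.erase_part_mem, π.addLast_removeLast]

theorem sup_id_mem {C : Finset ℕ} (hC : C.Nonempty) : C.sup id ∈ C := by
  obtain ⟨m, hm, h⟩ := Finset.exists_mem_eq_sup C hC id
  rw [h]
  exact hm

theorem le_sup_id {C : Finset ℕ} {m : ℕ} (hm : m ∈ C) : m ≤ C.sup id :=
  Finset.le_sup (f := id) hm

theorem setPartitionArcs_addLast_empty {n : ℕ} (π : Finpartition (Finset.Icc 1 n))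
    (h : ∅ ∈ insert ∅ π.parts) : setPartitionArcs (π.addLast ∅ h) = setPartitionArcs π := by
  ext ⟨i, j⟩
  rw [mem_setPartitionArcs, mem_setPartitionArcs, Finpartition.parts_addLast,
    Finset.erase_eq_of_notMem π.empty_notMem_parts]
  refine and_congr_right fun hij => ⟨?_, ?_⟩
  · rintro ⟨B, hB, hi, hj, hm⟩
    rcases Finset.mem_insert.mp hB with rfl | hB
    · simp only [insert_empty_eq, Finset.mem_singleton] at hi hj
      omega
    · exact ⟨B, hB, hi, hj, hm⟩
  · rintro ⟨B, hB, h⟩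
    exact ⟨B, Finset.mem_insert_of_mem hB, h⟩

/-- As n + 1 exceeds all other elements, it lies inside no old arc, and its predecessor in the block
is the maximum of C. -/
theorem setPartitionArcs_addLast {n : ℕ} (π : Finpartition (Finset.Icc 1 n)) {C : Finset ℕ}
    (hC : C ∈ π.parts) : setPartitionArcs (π.addLast C (Finset.mem_insert_of_mem hC))
      = insert (C.sup id, n + 1) (setPartitionArcs π) := by
  have hsup := sup_id_mem (π.nonempty_of_mem_parts hC)
  ext ⟨i, j⟩
  rw [Finset.mem_insert, mem_setPartitionArcs, mem_setPartitionArcs, Finpartition.parts_addLast,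
    Prod.mk.injEq]
  constructor
  · rintro ⟨hij, B, hB, hi, hj, hm⟩
    rcases Finset.mem_insert.mp hB with rfl | hB
    · rcases Finset.mem_insert.mp hj with rfl | hj
      · have hi := Finset.mem_of_mem_insert_of_ne hi hij.ne
        have h1 := hm _ (Finset.mem_insert_of_mem hsup)
        have h2 := le_sup_id hi
        have h3 := le_of_mem_part hC hsup
        exact Or.inl ⟨by omega, rfl⟩
      · have h3 := le_of_mem_part hC hj
        have hi := Finset.mem_of_mem_insert_of_ne hi (by omega)
        exact Or.inr ⟨hij, C, hC, hi, hj, fun m h => hm m (Finset.mem_insert_of_mem h)⟩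
    · exact Or.inr ⟨hij, B, Finset.mem_of_mem_erase hB, hi, hj, hm⟩
  · rintro (⟨rfl, rfl⟩ | ⟨hij, B, hB, hi, hj, hm⟩)
    · have h3 := le_of_mem_part hC hsup
      refine ⟨by omega, insert (n + 1) C, by simp, Finset.mem_insert_of_mem hsup, by simp, ?_⟩
      intro m hm
      rcases Finset.mem_insert.mp hm with rfl | hm
      · omega
      · have := le_sup_id hm
        omega
    · refine ⟨hij, ?_⟩
      by_cases h : B = C
      · subst h
        refine ⟨insert (n + 1) B, by simp, Finset.mem_insert_of_mem hi,
          Finset.mem_insert_of_mem hj, fun m h => ?_⟩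
        rcases Finset.mem_insert.mp h with rfl | h
        · have := le_of_mem_part hB hj
          omega
        · exact hm m h
      · exact ⟨B, by simp [h, hB], hi, hj, hm⟩

theorem card_parts_addLast_empty {n : ℕ} (π : Finpartition (Finset.Icc 1 n))
    (h : ∅ ∈ insert ∅ π.parts) : (π.addLast ∅ h).parts.card = π.parts.card + 1 := by
  rw [Finpartition.parts_addLast, Finset.erase_eq_of_notMem π.empty_notMem_parts,
    Finset.card_insert_of_notMem]
  intro h
  exact succ_notMem_of_mem (Finset.mem_insert_of_mem h) (by simp)

theorem card_parts_addLast {n : ℕ} (π : Finpartition (Finset.Icc 1 n)) {C : Finset ℕ}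
    (hC : C ∈ π.parts) :
    (π.addLast C (Finset.mem_insert_of_mem hC)).parts.card = π.parts.card := by
  rw [Finpartition.parts_addLast, Finset.card_insert_of_notMem, Finset.card_erase_add_one hC]
  intro h
  exact succ_notMem_of_mem (Finset.mem_insert_of_mem (Finset.mem_of_mem_erase h)) (by simp)

/-- The elements of `{1, …, n}` which are not the left end of an arc in `A`. -/
def openPoints (n : ℕ) (A : Finset (ℕ × ℕ)) : Finset ℕ :=
  Finset.Icc 1 n \ A.image Prod.fst

theorem mem_openPoints_setPartitionArcs {n : ℕ} {π : Finpartition (Finset.Icc 1 n)} {a : ℕ}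
    {C : Finset ℕ} (hC : C ∈ π.parts) (ha : a ∈ C) :
    a ∈ openPoints n (setPartitionArcs π) ↔ C.sup id = a := by
  rw [openPoints, Finset.mem_sdiff, and_iff_right (π.subset hC ha)]
  constructor
  · intro h
    by_contra hne
    have hlt : a < C.sup id := lt_of_le_of_ne (le_sup_id ha) (Ne.symm hne)
    have hex : ∃ m, m ∈ C ∧ a < m := ⟨_, sup_id_mem ⟨a, ha⟩, hlt⟩
    classical
    -- The least larger element of the block is the right end of an arc from a.
    refine h (Finset.mem_image.mpr ⟨(a, Nat.find hex), ?_, rfl⟩)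
    refine mem_setPartitionArcs.mpr ⟨(Nat.find_spec hex).2, C, hC, ha, (Nat.find_spec hex).1, ?_⟩
    exact fun m hm h => Nat.find_min hex h.2 ⟨hm, h.1⟩
  · rintro rfl h
    obtain ⟨⟨i, j⟩, hx, hi⟩ := Finset.mem_image.mp h
    obtain ⟨hij, B, hB, hiB, hjB, -⟩ := mem_setPartitionArcs.mp hx
    simp only at hi
    rw [← hi] at ha
    rw [π.eq_of_mem_parts hB hC hiB ha] at hjB
    have := le_sup_id hjB
    omega

theorem sum_parts_eq_sum_openPoints {M : Type*} [AddCommMonoid M] {n : ℕ}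
    (π : Finpartition (Finset.Icc 1 n)) (f : ℕ → M) :
    ∑ C ∈ π.parts, f (C.sup id) = ∑ a ∈ openPoints n (setPartitionArcs π), f a := by
  refine Finset.sum_bij' (fun C _ => C.sup id) (fun a _ => π.part a) ?_ ?_ ?_ ?_ ?_
  · intro C hC
    exact (mem_openPoints_setPartitionArcs hC (sup_id_mem (π.nonempty_of_mem_parts hC))).mpr rfl
  · intro a ha
    exact π.part_mem.mpr (Finset.mem_sdiff.mp ha).1
  · intro C hC
    exact π.part_eq_of_mem hC (sup_id_mem (π.nonempty_of_mem_parts hC))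
  · intro a ha
    have h := (Finset.mem_sdiff.mp ha).1
    exact (mem_openPoints_setPartitionArcs (π.part_mem.mpr h) (π.mem_part_self.mpr h)).mp ha
  · exact fun _ _ => rfl

/-- The recursion involves only the arc set and the number of blocks: blocks are represented by
their maxima, which are the open points. -/
theorem sum_setPartitionArcs_succ {M : Type*} [AddCommMonoid M] (n : ℕ)
    (F : Finset (ℕ × ℕ) → ℕ → M) :
    ∑ π : Finpartition (Finset.Icc 1 (n + 1)), F (setPartitionArcs π) π.parts.card
      = ∑ π : Finpartition (Finset.Icc 1 n), (F (setPartitionArcs π) (π.parts.card + 1)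
        + ∑ a ∈ openPoints n (setPartitionArcs π),
            F (insert (a, n + 1) (setPartitionArcs π)) π.parts.card) := by
  rw [sum_finpartition_Icc_succ]
  refine Finset.sum_congr rfl fun π _ => ?_
  have h : ∀ C ∈ (insert ∅ π.parts).attach,
      F (setPartitionArcs (π.addLast C.1 C.2)) (π.addLast C.1 C.2).parts.card
        = (fun C : Finset ℕ => if C = ∅ then F (setPartitionArcs π) (π.parts.card + 1)
          else F (insert (C.sup id, n + 1) (setPartitionArcs π)) π.parts.card) C.1 := by
    rintro ⟨C, hC⟩ -
    by_cases h : C = ∅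
    · subst h
      simp [setPartitionArcs_addLast_empty, card_parts_addLast_empty]
    · have hC' := Finset.mem_of_mem_insert_of_ne hC h
      simp [h, setPartitionArcs_addLast π hC', card_parts_addLast π hC']
  rw [Finset.sum_congr rfl h, Finset.sum_attach (insert ∅ π.parts)
    (fun C : Finset ℕ => if C = ∅ then F (setPartitionArcs π) (π.parts.card + 1)
          else F (insert (C.sup id, n + 1) (setPartitionArcs π)) π.parts.card),
    Finset.sum_insert π.empty_notMem_parts, if_pos rfl]
  congr 1
  rw [← sum_parts_eq_sum_openPoints π fun a => F (insert (a, n + 1) (setPartitionArcs π))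
    π.parts.card]
  exact Finset.sum_congr rfl fun C hC => if_neg (π.ne_empty hC)

end Arcs

/-! ### Crossings and weighted Motzkin paths -/

section CrossingWeight

/-- The number of crossings of a set of arcs. -/
def crossingNumber (A : Finset (ℕ × ℕ)) : ℕ :=
  ∑ x ∈ A, ∑ y ∈ A, if x.1 < y.1 ∧ y.1 < x.2 ∧ x.2 < y.2 then 1 else 0

/-- The number of crossings of the arcs in `A` with half-infinite arcs starting in `O`. -/
def halfCrossingNumber (A : Finset (ℕ × ℕ)) (O : Finset ℕ) : ℕ :=
  ∑ x ∈ A, ∑ c ∈ O, if x.1 < c ∧ c < x.2 then 1 else 0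

theorem setPartitionCro_eq_crossingNumber {n : ℕ} (π : Finpartition (Finset.Icc 1 n)) :
    setPartitionCro π = crossingNumber (setPartitionArcs π) := by
  rw [setPartitionCro, Finset.card_filter, Finset.sum_product, crossingNumber]

theorem halfCrossingNumber_insert_right {A : Finset (ℕ × ℕ)} {O : Finset ℕ} {a : ℕ} (ha : a ∉ O) :
    halfCrossingNumber A (insert a O)
      = (∑ x ∈ A, if x.1 < a ∧ a < x.2 then 1 else 0) + halfCrossingNumber A O := by
  simp only [halfCrossingNumber, Finset.sum_insert ha, Finset.sum_add_distrib]

theorem halfCrossingNumber_insert_succ {n : ℕ} {A : Finset (ℕ × ℕ)} {O : Finset ℕ}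
    (hA : ∀ x ∈ A, x.2 ≤ n + 1) (hO : n + 1 ∉ O) :
    halfCrossingNumber A (insert (n + 1) O) = halfCrossingNumber A O := by
  rw [halfCrossingNumber_insert_right hO, Finset.sum_eq_zero, zero_add]
  intro x hx
  have := hA x hx
  rw [if_neg (by omega)]

theorem halfCrossingNumber_insert_left {n a : ℕ} {A : Finset (ℕ × ℕ)} {O : Finset ℕ}
    (hA : ∀ x ∈ A, x.2 ≤ n) (hO : ∀ c ∈ O, c ≤ n) :
    halfCrossingNumber (insert (a, n + 1) A) O
      = (O.filter (a < ·)).card + halfCrossingNumber A O := by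
  rw [halfCrossingNumber, Finset.sum_insert, Finset.card_filter, halfCrossingNumber]
  · congr 1
    refine Finset.sum_congr rfl fun c hc => if_congr ?_ rfl rfl
    have := hO c hc
    simp only
    omega
  · intro h
    have := hA _ h
    simp only at this
    omega

/-- The new arc ends last, so it can only be the right-hand arc of a crossing. It gains exactly what
a half-infinite arc from a already had with A, so closing that arc loses nothing. -/
theorem crossingNumber_insert {n a : ℕ} {A : Finset (ℕ × ℕ)} (hA : ∀ x ∈ A, x.2 ≤ n) :
    crossingNumber (insert (a, n + 1) A)
      = crossingNumber A + ∑ x ∈ A, if x.1 < a ∧ a < x.2 then 1 else 0 := by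
  have hn : (a, n + 1) ∉ A := fun h => by
    have := hA _ h
    simp only at this
    omega
  rw [crossingNumber, Finset.sum_insert hn, Finset.sum_insert hn, crossingNumber]
  simp only [Finset.sum_insert hn, Finset.sum_add_distrib]
  rw [if_neg (by omega), Finset.sum_eq_zero, zero_add, zero_add, add_comm]
  · congr 1
    refine Finset.sum_congr rfl fun x hx => if_congr ?_ rfl rfl
    have := hA x hx
    omega
  · intro x hx
    have := hA x hx
    rw [if_neg (by omega)]

variable {R : Type*} [CommRing R] (q : R)

/-- The exponents run through 0, …, |O| - 1; a new minimum contributes the top power and leaves the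
others unchanged. -/
theorem sum_pow_card_filter_lt (O : Finset ℕ) :
    ∑ a ∈ O, q ^ (O.filter (a < ·)).card = qInteger q O.card := by
  induction O using Finset.induction_on_min with
  | empty => simp [qInteger]
  | insert a s has ih =>
    have ha : a ∉ s := fun h => lt_irrefl a (has a h)
    rw [Finset.sum_insert ha, Finset.card_insert_of_notMem ha, qInteger, Finset.sum_range_succ,
      ← qInteger, ← ih, add_comm]
    congr 1
    · refine Finset.sum_congr rfl fun b hb => ?_
      rw [Finset.filter_insert, if_neg (not_lt_of_gt (has b hb))]
    · rw [Finset.filter_insert, if_neg (lt_irrefl a), Finset.filter_true_of_mem has]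

/-- The generating function of the sets of `h` open points, with respect to crossings. -/
def openWeight (n : ℕ) (A : Finset (ℕ × ℕ)) (h : ℕ) : R :=
  ∑ O ∈ (openPoints n A).powersetCard h, q ^ (crossingNumber A + halfCrossingNumber A O)

theorem sum_powersetCard_insert {s : Finset ℕ} {x : ℕ} (hx : x ∉ s) (f : Finset ℕ → R) (h : ℕ) :
    ∑ O ∈ (insert x s).powersetCard h, f O
      = ∑ O ∈ s.powersetCard h, f O
        + shiftRight (fun i => ∑ O ∈ s.powersetCard i, f (insert x O)) h := by
  cases h with
  | zero => simp [shiftRight]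
  | succ h =>
    have hnot : ∀ i, ∀ O ∈ s.powersetCard i, x ∉ O := fun i O hO hxO =>
      hx ((Finset.mem_powersetCard.mp hO).1 hxO)
    rw [Finset.powersetCard_succ_insert hx, Finset.sum_union, Finset.sum_image]
    · rfl
    · intro O hO O' hO' heq
      rw [← Finset.erase_insert (hnot h O hO), heq, Finset.erase_insert (hnot h O' hO')]
    · rw [Finset.disjoint_left]
      intro O hO hO'
      obtain ⟨P, -, rfl⟩ := Finset.mem_image.mp hO'
      exact hnot _ _ hO (Finset.mem_insert_self _ _)

theorem succ_notMem_openPoints (n : ℕ) (A : Finset (ℕ × ℕ)) : n + 1 ∉ openPoints n A := by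
  simp [openPoints]

theorem le_of_mem_openPoints {n a : ℕ} {A : Finset (ℕ × ℕ)} (ha : a ∈ openPoints n A) : a ≤ n :=
  (Finset.mem_Icc.mp (Finset.mem_sdiff.mp ha).1).2

theorem openPoints_succ {n : ℕ} {A : Finset (ℕ × ℕ)} (hA : ∀ x ∈ A, x.1 ≤ n) :
    openPoints (n + 1) A = insert (n + 1) (openPoints n A) := by
  have h : n + 1 ∉ A.image Prod.fst := fun h => by
    obtain ⟨x, hx, hx'⟩ := Finset.mem_image.mp h
    have := hA x hx
    omega
  rw [openPoints, openPoints, ← Finset.insert_sdiff_of_notMem _ h]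
  congr 1
  ext m
  rw [Finset.mem_insert, Finset.mem_Icc, Finset.mem_Icc]
  omega

theorem openPoints_insert (n a b : ℕ) (A : Finset (ℕ × ℕ)) :
    openPoints n (insert (a, b) A) = (openPoints n A).erase a := by
  rw [openPoints, openPoints, Finset.image_insert, Finset.sdiff_insert]

/-- Here n + 1 starts a new block and is either unmarked or marked; no arc passes over it, so no
crossing arises. -/
theorem openWeight_succ {n : ℕ} {A : Finset (ℕ × ℕ)} (hA : ∀ x ∈ A, x.1 < x.2 ∧ x.2 ≤ n)
    (h : ℕ) : openWeight q (n + 1) A h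
      = openWeight q n A h + shiftRight (openWeight q n A) h := by
  rw [openWeight, openPoints_succ fun x hx => ((hA x hx).1.trans_le (hA x hx).2).le,
    sum_powersetCard_insert (succ_notMem_openPoints n A), openWeight]
  congr 2
  funext i
  refine Finset.sum_congr rfl fun O hO => ?_
  rw [halfCrossingNumber_insert_succ fun x hx => (hA x hx).2.trans (Nat.le_succ n)]
  exact fun h => succ_notMem_openPoints n A ((Finset.mem_powersetCard.mp hO).1 h)

theorem sum_sum_powersetCard_erase (s : Finset ℕ) (h : ℕ) (f : ℕ → Finset ℕ → R) :
    ∑ a ∈ s, ∑ O ∈ (s.erase a).powersetCard h, f a (insert a O)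
      = ∑ O ∈ s.powersetCard (h + 1), ∑ a ∈ O, f a O := by
  rw [Finset.sum_sigma', Finset.sum_sigma']
  refine Finset.sum_bij' (fun x _ => ⟨insert x.1 x.2, x.1⟩) (fun x _ => ⟨x.2, x.1.erase x.2⟩)
    ?_ ?_ ?_ ?_ ?_
  · rintro ⟨a, O⟩ hx
    simp only [Finset.mem_sigma, Finset.mem_powersetCard, Finset.subset_erase] at hx ⊢
    exact ⟨⟨Finset.insert_subset hx.1 hx.2.1.1, by
      rw [Finset.card_insert_of_notMem hx.2.1.2, hx.2.2]⟩, Finset.mem_insert_self _ _⟩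
  · rintro ⟨O, a⟩ hx
    simp only [Finset.mem_sigma, Finset.mem_powersetCard] at hx ⊢
    exact ⟨hx.1.1 hx.2, Finset.erase_subset_erase _ hx.1.1, by
      rw [Finset.card_erase_of_mem hx.2, hx.1.2, Nat.add_sub_cancel]⟩
  · rintro ⟨a, O⟩ hx
    simp only [Finset.mem_sigma, Finset.mem_powersetCard, Finset.subset_erase] at hx
    simp only [Finset.erase_insert hx.2.1.2]
  · rintro ⟨O, a⟩ hx
    simp only [Finset.mem_sigma] at hx
    simp only [Finset.insert_erase hx.2]
  · exact fun _ _ => rfl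

/-- Here n + 1 closes the half-infinite arc at a. Adding a to the marked old points gives h + 1
marks if n + 1 is unmarked and h if it is marked. Summing over a in this set, with one new crossing
for each mark after a, gives the q-integer. -/
theorem sum_openWeight_insert {n : ℕ} {A : Finset (ℕ × ℕ)} (hA : ∀ x ∈ A, x.1 < x.2 ∧ x.2 ≤ n)
    (h : ℕ) : ∑ a ∈ openPoints n A, openWeight q (n + 1) (insert (a, n + 1) A) h
      = qInteger q h * openWeight q n A h
        + qInteger q (h + 1) * openWeight q n A (h + 1) := by
  set s := openPoints n A with hs
  have hA2 : ∀ x ∈ A, x.2 ≤ n := fun x hx => (hA x hx).2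
  have h1 : ∀ a ∈ s, ∀ i, ∀ O ∈ (s.erase a).powersetCard i,
      crossingNumber (insert (a, n + 1) A) + halfCrossingNumber (insert (a, n + 1) A) O
        = crossingNumber A + halfCrossingNumber A (insert a O)
          + ((insert a O).filter (a < ·)).card := by
    intro a ha i O hO
    have hO' := (Finset.subset_erase.mp (Finset.mem_powersetCard.mp hO).1)
    rw [crossingNumber_insert hA2, halfCrossingNumber_insert_right hO'.2,
      halfCrossingNumber_insert_left hA2 fun c hc => le_of_mem_openPoints (hO'.1 hc),
      Finset.filter_insert, if_neg (lt_irrefl a)]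
    ring
  have h2 : ∀ i, ∑ a ∈ s, ∑ O ∈ (s.erase a).powersetCard i,
      q ^ (crossingNumber (insert (a, n + 1) A) + halfCrossingNumber (insert (a, n + 1) A) O)
        = qInteger q (i + 1) * openWeight q n A (i + 1) := by
    intro i
    have h3 := sum_sum_powersetCard_erase s i fun a O =>
      q ^ (crossingNumber A + halfCrossingNumber A O + (O.filter (a < ·)).card)
    rw [Finset.sum_congr rfl fun a ha => Finset.sum_congr rfl fun O hO => by rw [h1 a ha i O hO],
      h3, openWeight, Finset.mul_sum]
    refine Finset.sum_congr rfl fun O hO => ?_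
    simp only [pow_add _ (_ + _)]
    rw [← Finset.mul_sum, sum_pow_card_filter_lt, (Finset.mem_powersetCard.mp hO).2, mul_comm]
  have h4 : ∀ a ∈ s, openWeight q (n + 1) (insert (a, n + 1) A) h
      = (∑ O ∈ (s.erase a).powersetCard h, q ^ (crossingNumber (insert (a, n + 1) A)
          + halfCrossingNumber (insert (a, n + 1) A) O))
        + shiftRight (fun i => ∑ O ∈ (s.erase a).powersetCard i,
          q ^ (crossingNumber (insert (a, n + 1) A)
            + halfCrossingNumber (insert (a, n + 1) A) O)) h := by
    intro a ha
    have hnot : n + 1 ∉ s.erase a := fun h =>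
      succ_notMem_openPoints n A (Finset.mem_of_mem_erase h)
    rw [openWeight, openPoints_insert,
      openPoints_succ fun x hx => ((hA x hx).1.trans_le (hA x hx).2).le, ← hs,
      Finset.erase_insert_of_ne (by have := le_of_mem_openPoints ha; omega),
      sum_powersetCard_insert hnot]
    congr 2
    funext i
    refine Finset.sum_congr rfl fun O hO => ?_
    rw [halfCrossingNumber_insert_succ]
    · intro x hx
      rcases Finset.mem_insert.mp hx with rfl | hx
      · rfl
      · exact (hA2 x hx).trans (Nat.le_succ n)
    · exact fun h => hnot ((Finset.mem_powersetCard.mp hO).1 h)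
  rw [Finset.sum_congr rfl h4, Finset.sum_add_distrib, h2, add_comm]
  congr 1
  cases h with
  | zero => simp [shiftRight, qInteger_zero]
  | succ h => exact h2 h

/-- Insertion gives up weight y and down weight [h+1]_q; the factor y^h moves y from the up steps to
the down steps. -/
theorem sum_openWeight_eq_motzkinWeight (y : R) (n h : ℕ) :
    ∑ π : Finpartition (Finset.Icc 1 n),
        y ^ π.parts.card * openWeight q n (setPartitionArcs π) h
      = y ^ h * motzkinWeight (fun i => y + qInteger q i) (fun i => y * qInteger q i) n h := by
  induction n generalizing h with
  | zero =>
    have : Unique (Finpartition (Finset.Icc 1 0)) :=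
      inferInstanceAs (Unique (Finpartition (⊥ : Finset ℕ)))
    have hp : (default : Finpartition (Finset.Icc 1 0)).parts = ∅ :=
      Finpartition.parts_eq_empty_iff.mpr rfl
    have ha : setPartitionArcs (default : Finpartition (Finset.Icc 1 0)) = ∅ := rfl
    rw [Fintype.sum_unique, hp, ha]
    rcases h with _ | h
    · simp [openWeight, motzkinWeight, crossingNumber, halfCrossingNumber]
    · have he : (∅ : Finset ℕ).powersetCard (h + 1) = ∅ :=
        Finset.powersetCard_eq_empty.mpr (by simp)
      simp [openWeight, motzkinWeight, openPoints, he]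
  | succ n ih =>
    rw [sum_setPartitionArcs_succ n fun A k => y ^ k * openWeight q (n + 1) A h]
    have h1 : ∀ π : Finpartition (Finset.Icc 1 n),
        y ^ (π.parts.card + 1) * openWeight q (n + 1) (setPartitionArcs π) h
          + ∑ a ∈ openPoints n (setPartitionArcs π),
            y ^ π.parts.card * openWeight q (n + 1) (insert (a, n + 1) (setPartitionArcs π)) h
        = y * shiftRight (fun i => y ^ π.parts.card * openWeight q n (setPartitionArcs π) i) h
          + (y + qInteger q h) * (y ^ π.parts.card * openWeight q n (setPartitionArcs π) h)
          + qInteger q (h + 1)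
            * (y ^ π.parts.card * openWeight q n (setPartitionArcs π) (h + 1)) := by
      intro π
      have hA : ∀ x ∈ setPartitionArcs π, x.1 < x.2 ∧ x.2 ≤ n := fun x hx =>
        le_of_mem_setPartitionArcs hx
      rw [← Finset.mul_sum, openWeight_succ q hA, sum_openWeight_insert q hA]
      cases h <;> simp only [shiftRight] <;> ring
    rw [Finset.sum_congr rfl fun π _ => h1 π, Finset.sum_add_distrib, Finset.sum_add_distrib,
      ← Finset.mul_sum, ← Finset.mul_sum, ← Finset.mul_sum, ih, ih, ← shiftRight_sum, motzkinWeight]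
    cases h with
    | zero => simp only [shiftRight]; ring
    | succ h => simp only [shiftRight, ih]; ring

theorem sum_pow_card_mul_pow_setPartitionCro (y : R) (n : ℕ) :
    ∑ π : Finpartition (Finset.Icc 1 n), y ^ π.parts.card * q ^ setPartitionCro π
      = motzkinWeight (fun i => y + qInteger q i) (fun i => y * qInteger q i) n 0 := by
  have h := sum_openWeight_eq_motzkinWeight q y n 0
  rw [pow_zero, one_mul] at h
  rw [← h]
  refine Finset.sum_congr rfl fun π _ => ?_
  simp [openWeight, halfCrossingNumber, setPartitionCro_eq_crossingNumber]

end CrossingWeight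

/-! ### Specialisation to rational functions and the theorem -/

section Main

open Polynomial

theorem qInteger_X_ne_zero (n : ℕ) : qInteger (RatFunc.X : RatFunc ℚ) (n + 1) ≠ 0 := by
  have h : qInteger (RatFunc.X : RatFunc ℚ) (n + 1)
      = algebraMap ℚ[X] (RatFunc ℚ) (qInteger X (n + 1)) := by
    rw [← map_qInteger, RatFunc.algebraMap_X]
  rw [h]
  intro h0
  rw [← map_zero (algebraMap ℚ[X] (RatFunc ℚ))] at h0
  replace h0 := RatFunc.algebraMap_injective ℚ h0
  -- At q = 1 the q-integer becomes n + 1, which is nonzero in ℚ.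
  have h1 := congrArg (Polynomial.eval 1) h0
  simp only [qInteger, eval_finsetSum, eval_pow, eval_X, one_pow, Finset.sum_const,
    Finset.card_range, nsmul_eq_mul, mul_one, eval_zero] at h1
  exact Nat.succ_ne_zero n (Nat.cast_eq_zero.mp h1)

theorem ratFunc_X_ne_one : (RatFunc.X : RatFunc ℚ) ≠ 1 := by
  intro h
  have h1 : algebraMap ℚ[X] (RatFunc ℚ) X = algebraMap ℚ[X] (RatFunc ℚ) 1 := by
    rw [RatFunc.algebraMap_X, h, map_one]
  have h2 := congrArg (Polynomial.eval 0) (RatFunc.algebraMap_injective ℚ h1)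
  simp at h2

/-- With y the variable of K[X], both sides are coefficients of y^k in the same path weight; for k >
n both vanish. -/
theorem sum_pow_setPartitionCro_eq_charlierFormula {K : Type*} [Field K] {q : K} (hq : q ≠ 1)
    (hqi : ∀ n, qInteger q (n + 1) ≠ 0) (n k : ℕ) :
    ∑ π : Finpartition (Finset.Icc 1 n) with π.parts.card = k, q ^ setPartitionCro π
      = charlierFormula q n k := by
  have h := congrArg (fun p => coeff p k) ((sum_pow_card_mul_pow_setPartitionCro (C q) X n).trans
    (motzkinWeight_eq_sum_charlierFormula hq hqi n))
  simp only [finsetSum_coeff, ← C_pow, mul_comm (X ^ _) (C _), coeff_C_mul_X_pow] at h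
  rw [Finset.sum_filter]
  simp only [@eq_comm _ _ k]
  rw [h, Finset.sum_ite_eq]
  split_ifs with hk
  · rfl
  · rw [charlierFormula_eq_zero]
    simpa using hk

end Main

theorem theorem2 :
    -- the generating function of set partitions, as an identity of rational functions in `q`
    (∀ n k : ℕ,
      (∑ π : Finpartition (Finset.Icc 1 n) with π.parts.card = k,
          (RatFunc.X : RatFunc ℚ) ^ setPartitionCro π)
        = charlierFormula (RatFunc.X : RatFunc ℚ) n k) ∧
    -- the moments of the `q`-Charlier polynomials, over `ℚ(q)[y]`
    (∃! L : Polynomial (Polynomial (RatFunc ℚ)) →ₗ[Polynomial (RatFunc ℚ)] Polynomial (RatFunc ℚ),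
      IsOrthogonalityFunctional
        (qCharlier (Polynomial.C (RatFunc.X : RatFunc ℚ)) Polynomial.X) L) ∧
    (∀ L : Polynomial (Polynomial (RatFunc ℚ)) →ₗ[Polynomial (RatFunc ℚ)] Polynomial (RatFunc ℚ),
      IsOrthogonalityFunctional
        (qCharlier (Polynomial.C (RatFunc.X : RatFunc ℚ)) Polynomial.X) L →
      ∀ n : ℕ, L (Polynomial.X ^ n) =
        ∑ k ∈ Finset.range (n + 1),
          Polynomial.C (charlierFormula (RatFunc.X : RatFunc ℚ) n k) * Polynomial.X ^ k) := by
  have h1 := ratFunc_X_ne_one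
  have h2 := qInteger_X_ne_zero
  have h3 := qCharlier_isThreeTerm (Polynomial.C (RatFunc.X : RatFunc ℚ)) Polynomial.X
  refine ⟨sum_pow_setPartitionCro_eq_charlierFormula h1 h2,
    h3.existsUnique_isOrthogonalityFunctional fun i => ?_, fun L hL n => ?_⟩
  · rw [map_qInteger]
    exact mul_ne_zero Polynomial.X_ne_zero (Polynomial.C_ne_zero.mpr (h2 i))
  · rw [h3.map_X_pow hL, motzkinWeight_eq_sum_charlierFormula h1 h2]
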